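/- All linkages consist of finitely many directed paths in a digraph $G$. A \emph{half-integral linkage} is a finite set $\mathcal{L}$ of directed paths of $G$ such that every vertex of $G$ lies on at most two paths of $\mathcal{L}$, no two distinct paths of $\mathcal{L}$ have the same starting vertex, and no two have the same ending vertex; $A(\mathcal{L})$ and $B(\mathcal{L})$ denote its sets of starting and of ending vertices (so $|A(\mathcal{L})|=|B(\mathcal{L})|=|\mathcal{L}|$). Two linkages $\mathcal{L},\mathcal{L}'$ are \emph{dual} to each other if $A(\mathcal{L})=B(\mathcal{L}')$ and $A(\mathcal{L}')=B(\mathcal{L})$. The \emph{intersection graph} $I(\mathcal{L},\mathcal{K})$ is the bipartite graph with classes $\mathcal{L}$ and $\mathcal{K}$ in which $L\in\mathcal{L}$ and $K\in\mathcal{K}$ are adjacent if they share a vertex. The \emph{directed treewidth} of a finite digraph $H$ is the least $w\ge 0$ for which there are a finite arborescence $R$, bags $\beta(t)\subseteq V(H)$ for the nodes $t$ of $R$ that partition $V(H)$ (bags may be empty), and guards $\gamma(e)\subseteq V(H)$ for the arcs $e$ of $R$ such that (i) for every arc $e=(s,t)$ of $R$, no closed directed walk of $H-\gamma(e)$ contains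 both a vertex of $S_e$ and a vertex of $V(H)\setminus S_e$, where $S_e$ is the union of the bags of the nodes in the subtree rooted at $t$; and (ii) $\bigl|\beta(t)\cup\bigcup_{e\ni t}\gamma(e)\bigr|\le w+1$ for every node $t$. \textbf{Lemma.} Let $k,d$ be positive integers and let $\mathcal{P},\mathcal{P}^{\mathrm{back}},\mathcal{Q},\mathcal{Q}^{\mathrm{back}}$ be four half-integral linkages in a digraph such that $\mathcal{P}$ and $\mathcal{P}^{\mathrm{back}}$ are dual to each other and $\mathcal{Q}$ and $\mathcal{Q}^{\mathrm{back}}$ are dual to each other. Assume $|\mathcal{P}|\ge 24k$, and let the intersection graph $I(\mathcal{P},\mathcal{Q})$ have minimum degree at least $d$, where $$d\;\ge\; 8k\,\log_{4/3}\!\left(\frac{|\mathcal{P}|}{24k}\right)+24k+4 .$$ Then the digraph $\bigcup(\mathcal{P}\cup\mathcal{P}^{\mathrm{back}}\cup\mathcal{Q}\cup\mathcal{Q}^{\mathrm{back}})$, formed by all vertices and arcs of these paths, has directed treewidth at least $k$. -/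

import Mathlib

namespace HalfIntegralLinkage

/-! ### Walks and paths in digraphs -/

/-- The nonempty vertex sequence `l` is a directed walk of `G`. -/
def IsWalk {V : Type*} (G : Digraph V) (l : List V) : Prop :=
  l ≠ [] ∧ l.IsChain G.Adj

/-- A directed path: a directed walk without repeated vertices
(a single vertex is a path of length zero). -/
structure DiPath {V : Type*} (G : Digraph V) where
  verts : List V
  isWalk : IsWalk G verts
  nodup : verts.Nodup

namespace DiPath

/-- The starting vertex of a path. -/
def start {V : Type*} {G : Digraph V} (p : DiPath G) : V := p.verts.head p.isWalk.1

/-- The ending vertex of a path. -/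
def finish {V : Type*} {G : Digraph V} (p : DiPath G) : V := p.verts.getLast p.isWalk.1

end DiPath

/-! ### Linkages -/

/-- The set `A(L)` of starting vertices of the paths in `L`. -/
def linkFrom {V : Type*} {G : Digraph V} (L : Finset (DiPath G)) : Set V :=
  DiPath.start '' (L : Set (DiPath G))

/-- The set `B(L)` of ending vertices of the paths in `L`. -/
def linkTo {V : Type*} {G : Digraph V} (L : Finset (DiPath G)) : Set V :=
  DiPath.finish '' (L : Set (DiPath G))

open Classical in
/-- `L` has congestion `c`: every vertex is visited at most `c` times in total. -/
def HasCongestion {V : Type*} {G : Digraph V} (c : ℕ) (L : Finset (DiPath G)) : Prop :=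
  ∀ v : V, ∑ p ∈ L, p.verts.count v ≤ c

/-- A half-integral linkage: a finite set of paths of congestion `2` which links the set
`A(L)` bijectively to the set `B(L)`, so that `|A(L)| = |B(L)| = |L|`. -/
structure IsHalfIntegralLinkage {V : Type*} {G : Digraph V} (L : Finset (DiPath G)) : Prop where
  start_injOn : Set.InjOn DiPath.start (L : Set (DiPath G))
  finish_injOn : Set.InjOn DiPath.finish (L : Set (DiPath G))
  congestion : HasCongestion 2 L

/-- Two linkages are dual to each other. -/
def AreDual {V : Type*} {G : Digraph V} (L L' : Finset (DiPath G)) : Prop :=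
  linkFrom L = linkTo L' ∧ linkFrom L' = linkTo L

/-- The intersection graph `I(L, K)`: the bipartite graph whose two classes are (copies of) `L`
and `K`, with an edge whenever the two paths share a vertex. -/
def intersectionGraph {V : Type*} {G : Digraph V} (L K : Finset (DiPath G)) :
    SimpleGraph ({p // p ∈ L} ⊕ {q // q ∈ K}) :=
  SimpleGraph.fromRel fun x y =>
    ∃ (p : {p // p ∈ L}) (q : {q // q ∈ K}), x = Sum.inl p ∧ y = Sum.inr q ∧
      ∃ v, v ∈ p.1.verts ∧ v ∈ q.1.verts

/-- The union of the paths in `F`: its vertices are the vertices of the paths in `F`, and its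
arcs are the pairs of consecutive vertices of paths in `F`. -/
def pathUnion {V : Type*} {G : Digraph V} (F : Set (DiPath G)) :
    Digraph {v : V // ∃ p ∈ F, v ∈ p.verts} where
  Adj u v := ∃ p ∈ F, [u.1, v.1] <:+: p.verts

/-! ### Directed treewidth -/

/-- A finite arborescence on the node set `T`, given by its root and its parent function.
Its arcs are the pairs `(parent t, t)` with `t ≠ root`. -/
structure Arborescence (T : Type*) where
  root : T
  parent : T → T
  parent_root : parent root = root
  reaches_root : ∀ t, ∃ n : ℕ, parent^[n] t = root

/-- `R.Below t s`: the node `s` lies in the subtree rooted at `t` (possibly `s = t`). -/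
def Arborescence.Below {T : Type*} (R : Arborescence T) (t s : T) : Prop :=
  ∃ n : ℕ, R.parent^[n] s = t

/-- A directed tree decomposition of `G` over an arborescence with node set `T`.
The bags partition the vertex set (bags may be empty). `guard t` is the guard `γ(e)` of the arc
`e = (parent t, t)`, and is used only for `t ≠ root`. The guard of `e` separates the union `S` of
the bags below `e` from its complement: no closed directed walk of `G - γ(e)` meets both.
(This holds in particular if `S` is `γ(e)`-normal.) -/
structure DirTreeDecomp {V : Type*} (G : Digraph V) (T : Type*) extends Arborescence T where
  bag : T → Set V
  guard : T → Set V
  bag_partition : ∀ v : V, ∃! t : T, v ∈ bag t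
  guarded : ∀ t : T, t ≠ root → ∀ (l : List V) (hl : IsWalk G l),
    l.head hl.1 = l.getLast hl.1 → (∀ v ∈ l, v ∉ guard t) →
    ∀ u ∈ l, ∀ v ∈ l, (∃ s, toArborescence.Below t s ∧ u ∈ bag s) →
      ∃ s, toArborescence.Below t s ∧ v ∈ bag s

/-- The set `Γ(t)`: the bag of `t` together with the guards of all arcs incident with `t`. -/
def DirTreeDecomp.fullBag {V : Type*} {G : Digraph V} {T : Type*} (D : DirTreeDecomp G T)
    (t : T) : Set V :=
  D.bag t ∪ {v | ∃ s, s ≠ D.root ∧ (s = t ∨ D.parent s = t) ∧ v ∈ D.guard s}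

/-- `G` has a directed tree decomposition of width at most `w`. -/
def HasDirTreeDecomp {V : Type*} (G : Digraph V) (w : ℕ) : Prop :=
  ∃ (n : ℕ) (D : DirTreeDecomp G (Fin (n + 1))), ∀ t, (D.fullBag t).encard ≤ w + 1

/-- The directed treewidth of a finite digraph: the least width of a directed tree
decomposition, where the width is the maximum of `|Γ(t)| - 1`. -/
noncomputable def directedTreewidth {V : Type*} (G : Digraph V) : ℕ :=
  sInf {w | HasDirTreeDecomp G w}

/-- Every finite digraph has a directed tree decomposition, so that the infimum above is
attained. -/
theorem exists_hasDirTreeDecomp {V : Type*} [Finite V] (G : Digraph V) :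
    ∃ w, HasDirTreeDecomp G w := by
  have hsub : Subsingleton (Fin (0 + 1)) := inferInstanceAs (Subsingleton (Fin 1))
  refine ⟨Nat.card V, 0,
    { root := 0
      parent := id
      parent_root := rfl
      reaches_root := fun t => ⟨0, Subsingleton.elim _ _⟩
      bag := fun _ => Set.univ
      guard := fun _ => ∅
      bag_partition := fun v => ⟨0, trivial, fun _ _ => Subsingleton.elim _ _⟩
      guarded := fun t ht => absurd (Subsingleton.elim _ _) ht }, fun t => ?_⟩
  refine (Set.encard_le_encard (Set.subset_univ _)).trans ?_
  rw [Set.encard_univ, ENat.card_eq_coe_natCard]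
  exact le_self_add

end HalfIntegralLinkage

namespace HalfIntegralLinkage

/-! Suppose the width is less than `k`. Then every family `M ⊆ P` is balanced by some full bag `X`
of a decomposition: `|X| ≤ k`, and no strongly connected set avoiding `X` holds more than half of
`M`. Descending in the arborescence towards the heavy subtree finds `X` (`exists_fullBag_balanced`).

Ordering the strong components outside `X` acyclically gives a set `D` closed under in-neighbours
such that one of the sides `D` and `(D ∪ X)ᶜ` holds some, but at most three quarters, of `M`
(`exists_balanced_side`). Duality makes this one-way cut cheap: an unhit path can only leave `D`,
and the back linkage must make up for each departure by a return, which has to hit `X`. So at most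
`6k` paths of each linkage are hit or cross (`card_pathsMeeting_union_crossing_le`).

Passing to the paths within that side shrinks `M` by a factor 3/4, so the logarithm falls by at
least 1, while degrees fall by at most `8k`; the assumed inequality therefore survives. Iterating,
`M` shrinks to at most `32k` paths, where the degree bound exceeds `|M|`, which is impossible
(`false_of_dense`). -/

open Classical in
/-- The paths of `L` all of whose vertices lie in `S`. -/
noncomputable def pathsWithin {V : Type*} {G : Digraph V} (L : Finset (DiPath G)) (S : Set V) :
    Finset (DiPath G) :=
  L.filter fun p => ∀ v ∈ p.verts, v ∈ S

open Classical in
/-- The paths of `L` meeting `X`. -/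
noncomputable def pathsMeeting {V : Type*} {G : Digraph V} (L : Finset (DiPath G)) (X : Set V) :
    Finset (DiPath G) :=
  L.filter fun p => ∃ v ∈ p.verts, v ∈ X

/-- The paths of `L` meeting both `S` and its complement. -/
noncomputable def pathsCrossing {V : Type*} {G : Digraph V} (L : Finset (DiPath G)) (S : Set V) :
    Finset (DiPath G) :=
  pathsMeeting (pathsMeeting L S) Sᶜ

/-- The arcs of the paths in `F`. -/
def unionArc {V : Type*} {G : Digraph V} (F : Set (DiPath G)) (u v : V) : Prop :=
  ∃ p ∈ F, [u, v] <:+: p.verts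

/-- The arcs of the paths in `F` that avoid `X`. -/
def arcAvoiding {V : Type*} {G : Digraph V} (F : Set (DiPath G)) (X : Set V) (u v : V) : Prop :=
  unionArc F u v ∧ u ∉ X ∧ v ∉ X

/-- The vertices of the paths in `F`. -/
def unionVerts {V : Type*} {G : Digraph V} (F : Set (DiPath G)) : Set V :=
  {v | ∃ p ∈ F, v ∈ p.verts}

/-- `D` is closed under taking in-neighbours along `r`. -/
def PredClosed {V : Type*} (r : V → V → Prop) (D : Set V) : Prop :=
  ∀ u v, r u v → v ∈ D → u ∈ D

section

variable {V : Type*} {G : Digraph V}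

theorem mem_pathsWithin {L : Finset (DiPath G)} {S : Set V} {p : DiPath G} :
    p ∈ pathsWithin L S ↔ p ∈ L ∧ ∀ v ∈ p.verts, v ∈ S := by
  simp [pathsWithin]

theorem mem_pathsMeeting {L : Finset (DiPath G)} {X : Set V} {p : DiPath G} :
    p ∈ pathsMeeting L X ↔ p ∈ L ∧ ∃ v ∈ p.verts, v ∈ X := by
  simp [pathsMeeting]

theorem mem_pathsCrossing {L : Finset (DiPath G)} {S : Set V} {p : DiPath G} :
    p ∈ pathsCrossing L S ↔ p ∈ L ∧ (∃ v ∈ p.verts, v ∈ S) ∧ ∃ v ∈ p.verts, v ∉ S := by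
  simp [pathsCrossing, mem_pathsMeeting, and_assoc]

/-! ### Paths and linkages across a one-way cut -/

theorem DiPath.isChain_arcAvoiding {F : Set (DiPath G)} {X : Set V} {p : DiPath G} (hp : p ∈ F)
    (hX : ∀ v ∈ p.verts, v ∉ X) : p.verts.IsChain (arcAvoiding F X) := by
  rw [List.isChain_iff_forall_rel_of_append_cons_cons]
  intro a b l₁ l₂ h
  exact ⟨⟨p, hp, l₁, l₂, by simp [h]⟩, hX _ (by simp [h]), hX _ (by simp [h])⟩

theorem DiPath.start_mem (p : DiPath G) : p.start ∈ p.verts := List.head_mem _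

theorem DiPath.mem_of_finish_mem {r : V → V → Prop} {D : Set V} (hD : PredClosed r D)
    {p : DiPath G} (hp : p.verts.IsChain r) (h : p.finish ∈ D) : ∀ v ∈ p.verts, v ∈ D :=
  List.IsChain.backwards_induction (· ∈ D) p.verts hp (fun {_ _} => hD _ _) (fun _ => h)

theorem DiPath.notMem_of_start_notMem {r : V → V → Prop} {D : Set V} (hD : PredClosed r D)
    {p : DiPath G} (hp : p.verts.IsChain r) (h : p.start ∉ D) : ∀ v ∈ p.verts, v ∉ D :=
  List.IsChain.induction (· ∉ D) p.verts hp (fun {_ _} hxy hx hy => hx (hD _ _ hxy hy))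
    (fun _ => h)

theorem card_pathsMeeting_le {L : Finset (DiPath G)} (hL : HasCongestion 2 L) {X : Set V} {k : ℕ}
    (hX : X.encard ≤ k) : (pathsMeeting L X).card ≤ 2 * k := by
  classical
  have hfin : X.Finite := Set.finite_of_encard_le_coe hX
  obtain ⟨X, rfl⟩ := hfin.exists_finset_coe
  rw [Set.encard_coe_eq_coe_finsetCard] at hX
  have hXk : X.card ≤ k := by exact_mod_cast hX
  have hsub : pathsMeeting L X ⊆ X.biUnion fun v => L.filter fun p => v ∈ p.verts := by
    intro p hp
    obtain ⟨hpL, v, hv, hvX⟩ := mem_pathsMeeting.1 hp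
    exact Finset.mem_biUnion.2 ⟨v, hvX, Finset.mem_filter.2 ⟨hpL, hv⟩⟩
  calc (pathsMeeting L X).card ≤ _ := Finset.card_le_card hsub
    _ ≤ X.card * 2 := by
        refine Finset.card_biUnion_le_card_mul _ _ _ fun v _ => ?_
        refine le_trans ?_ (hL v)
        rw [Finset.card_filter]
        refine Finset.sum_le_sum fun p _ => ?_
        split_ifs with h
        · convert List.one_le_count_iff.2 h
        · exact Nat.zero_le _
    _ ≤ 2 * k := by omega

-- Both sides count `A(L) ∩ D = B(L') ∩ D`, since starts are injective on `L` and ends on `L'`.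
open Classical in
theorem card_filter_start {L L' : Finset (DiPath G)} (hL : IsHalfIntegralLinkage L)
    (hL' : IsHalfIntegralLinkage L') (h : linkFrom L = linkTo L') (D : Set V) :
    (L.filter fun p => p.start ∈ D).card = (L'.filter fun p => p.finish ∈ D).card := by
  have e1 : (L.filter fun p => p.start ∈ D).card = (linkFrom L ∩ D).ncard := by
    rw [← Set.ncard_coe_finset,
      ← (hL.start_injOn.mono (by intro p; simp +contextual)).ncard_image]
    congr 1
    ext v
    simp only [linkFrom, Set.mem_image, Finset.coe_filter, Set.mem_ofPred_eq, Set.mem_inter_iff,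
      Finset.mem_coe]
    aesop
  have e2 : (L'.filter fun p => p.finish ∈ D).card = (linkTo L' ∩ D).ncard := by
    rw [← Set.ncard_coe_finset,
      ← (hL'.finish_injOn.mono (by intro p; simp +contextual)).ncard_image]
    congr 1
    ext v
    simp only [linkTo, Set.mem_image, Finset.coe_filter, Set.mem_ofPred_eq, Set.mem_inter_iff,
      Finset.mem_coe]
    aesop
  rw [e1, e2, h]

/-- Deleting `k` vertices from a union of paths, few paths of a linkage with a dual are hit or
leave a set that is closed under taking in-neighbours. -/
theorem card_pathsMeeting_union_crossing_le [DecidableEq (DiPath G)] {L L' : Finset (DiPath G)}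
    (hL : IsHalfIntegralLinkage L) (hL' : IsHalfIntegralLinkage L') (hdual : AreDual L L')
    {F : Set (DiPath G)} (hLF : ↑L ⊆ F) (hLF' : ↑L' ⊆ F) {X D : Set V} {k : ℕ}
    (hX : X.encard ≤ k) (hD : PredClosed (arcAvoiding F X) D) :
    (pathsMeeting L X ∪ pathsCrossing L D).card ≤ 6 * k := by
  classical
  -- Entering `D` from outside is possible only through `X`.
  have returning : ∀ M : Finset (DiPath G), ↑M ⊆ F →
      (M.filter fun p => p.start ∉ D ∧ p.finish ∈ D) ⊆ pathsMeeting M X := by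
    intro M hM p hp
    obtain ⟨hpM, hs, hf⟩ := Finset.mem_filter.1 hp
    refine mem_pathsMeeting.2 ⟨hpM, ?_⟩
    by_contra! hpX
    exact hs (DiPath.mem_of_finish_mem hD (DiPath.isChain_arcAvoiding (hM hpM) hpX) hf _
      p.start_mem)
  have hsub : pathsMeeting L X ∪ pathsCrossing L D ⊆
      pathsMeeting L X ∪ L.filter fun p => p.start ∈ D ∧ p.finish ∉ D := by
    intro p hp
    by_cases hpX : p ∈ pathsMeeting L X
    · exact Finset.mem_union_left _ hpX
    have hpc := (Finset.mem_union.1 hp).resolve_left hpX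
    obtain ⟨hpL, ⟨v, hv, hvD⟩, w, hw, hwD⟩ := mem_pathsCrossing.1 hpc
    have hpX' : ∀ v ∈ p.verts, v ∉ X := fun v hv hvX =>
      hpX (mem_pathsMeeting.2 ⟨hpL, v, hv, hvX⟩)
    have hch := DiPath.isChain_arcAvoiding (hLF hpL) hpX'
    refine Finset.mem_union_right _ (Finset.mem_filter.2 ⟨hpL, ?_, fun h => ?_⟩)
    · by_contra h
      exact DiPath.notMem_of_start_notMem hD hch h v hv hvD
    · exact hwD (DiPath.mem_of_finish_mem hD hch h w hw)
  have split : ∀ M : Finset (DiPath G),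
      (M.filter fun p => p.start ∈ D).card + (M.filter fun p => p.start ∉ D ∧ p.finish ∈ D).card =
      (M.filter fun p => p.finish ∈ D).card +
        (M.filter fun p => p.start ∈ D ∧ p.finish ∉ D).card := by
    intro M
    simp only [Finset.card_filter, ← Finset.sum_add_distrib]
    refine Finset.sum_congr rfl fun p _ => ?_
    by_cases h1 : p.start ∈ D <;> by_cases h2 : p.finish ∈ D <;> simp [h1, h2]
  -- Adding the balances of `L` and `L'`, starts and ends cancel by duality. Hence the paths leaving
  -- `D` in both linkages are as many as those returning, at most `2k + 2k`; the paths of `L` hit by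
  -- `X` add another `2k`.
  have s1 := split L
  have s2 := split L'
  have e1 := card_filter_start hL hL' hdual.1 D
  have e2 := card_filter_start hL' hL hdual.2 D
  have r1 := Finset.card_le_card (returning L hLF)
  have r2 := Finset.card_le_card (returning L' hLF')
  have h1 := card_pathsMeeting_le hL.congestion hX
  have h2 := card_pathsMeeting_le hL'.congestion hX
  have h3 := (Finset.card_le_card hsub).trans (Finset.card_union_le _ _)
  omega

/-! ### Balanced sides of a cut -/

theorem finite_unionVerts {F : Set (DiPath G)} (hF : F.Finite) : (unionVerts F).Finite := by
  have : unionVerts F = ⋃ p ∈ F, {v | v ∈ p.verts} := by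
    ext v
    simp [unionVerts]
  rw [this]
  exact hF.biUnion fun p _ => p.verts.finite_toSet

theorem pathsWithin_mono {L : Finset (DiPath G)} {S S' : Set V} (h : S ⊆ S') :
    pathsWithin L S ⊆ pathsWithin L S' := by
  intro p hp
  rw [mem_pathsWithin] at hp ⊢
  exact ⟨hp.1, fun v hv => h (hp.2 v hv)⟩

theorem pathsWithin_subset (L : Finset (DiPath G)) (S : Set V) : pathsWithin L S ⊆ L :=
  fun _ hp => (mem_pathsWithin.1 hp).1

theorem disjoint_pathsWithin {L : Finset (DiPath G)} {S S' : Set V} (h : Disjoint S S') :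
    Disjoint (pathsWithin L S) (pathsWithin L S') := by
  rw [Finset.disjoint_left]
  intro p hp hp'
  exact Set.disjoint_left.1 h ((mem_pathsWithin.1 hp).2 _ p.start_mem)
    ((mem_pathsWithin.1 hp').2 _ p.start_mem)

/-- The paths of a subfamily that are neither hit by `X` nor cross `D` lie on one of the sides. -/
theorem card_le_card_pathsWithin_add [DecidableEq (DiPath G)] {L M : Finset (DiPath G)}
    (hM : M ⊆ L) (X D : Set V) :
    M.card ≤ (pathsWithin M D).card + (pathsWithin M (D ∪ X)ᶜ).card +
      (pathsMeeting L X ∪ pathsCrossing L D).card := by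
  refine le_trans (Finset.card_le_card fun p hp => ?_)
    ((Finset.card_union_le _ _).trans (Nat.add_le_add_right (Finset.card_union_le _ _) _))
  by_contra hcon
  simp only [Finset.mem_union, mem_pathsWithin, mem_pathsMeeting, mem_pathsCrossing, hp, hM hp,
    true_and, not_or, not_and, not_exists, Set.mem_compl_iff, Set.mem_union, not_forall,
    not_not] at hcon
  obtain ⟨⟨⟨w, hw, hwD⟩, v, hv, hvDX⟩, hX, hD⟩ := hcon
  by_cases hvD : v ∈ D
  · exact hwD (hD ⟨v, hv, hvD⟩ w hw)
  · exact hX v hv (hvDX hvD)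

/-- A digraph in which the deletion of `X` leaves no strong component with more than half of
the paths of `M` has a side of a cut that contains at least one and at most three quarters of
the paths of `M`. -/
theorem exists_balanced_side {F : Set (DiPath G)} (hF : F.Finite) {M : Finset (DiPath G)}
    (hMF : ↑M ⊆ F) {X : Set V} {b : ℕ}
    (hbad : ∀ D, PredClosed (arcAvoiding F X) D →
      M.card ≤ (pathsWithin M D).card + (pathsWithin M (D ∪ X)ᶜ).card + b)
    (hb : 2 * b < M.card)
    (hX : ∀ C : Set V, (∀ u ∈ C, ∀ v ∈ C, Relation.ReflTransGen (arcAvoiding F X) u v) →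
      C ⊆ unionVerts F → Disjoint C X → 2 * (pathsWithin M C).card ≤ M.card) :
    ∃ D, PredClosed (arcAvoiding F X) D ∧ ∃ S, (S = D ∨ S = (D ∪ X)ᶜ) ∧
      0 < (pathsWithin M S).card ∧ 4 * (pathsWithin M S).card ≤ 3 * M.card := by
  set r := arcAvoiding F X with hr
  set U := unionVerts F \ X with hU
  have hUfin : U.Finite := (finite_unionVerts hF).sdiff
  have hUclosed : PredClosed r U := by
    rintro u v ⟨⟨p, hp, hi⟩, huX, -⟩ -
    exact ⟨⟨p, hp, hi.subset (by simp)⟩, huX⟩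
  let small : Set (Set V) := {D | D ⊆ U ∧ PredClosed r D ∧ 4 * (pathsWithin M D).card < M.card}
  have hsmallfin : small.Finite := hUfin.finite_subsets.subset fun D hD => hD.1
  have hempty : (pathsWithin M ∅).card = 0 := by
    rw [Finset.card_eq_zero, Finset.eq_empty_iff_forall_notMem]
    intro p hp
    exact (mem_pathsWithin.1 hp).2 _ p.start_mem
  -- `D` is a maximal closed set with less than a quarter of `M`. Below, `E` is a minimal closed set
  -- strictly above it, so `E \ D` is strongly connected.
  obtain ⟨D, hDmax⟩ := hsmallfin.exists_maximal
    ⟨∅, Set.empty_subset _, fun _ _ _ h => h.elim, by omega⟩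
  obtain ⟨hDU, hDc, hDs⟩ := hDmax.prop
  have hUnotsmall : ¬ 4 * (pathsWithin M U).card < M.card := by
    have h1 := hbad U hUclosed
    have h2 : (pathsWithin M (U ∪ X)ᶜ).card = 0 := by
      rw [Finset.card_eq_zero, Finset.eq_empty_iff_forall_notMem]
      intro p hp
      obtain ⟨hpM, hpU⟩ := mem_pathsWithin.1 hp
      have h3 := hpU _ p.start_mem
      simp only [hU, Set.sdiff_union_self, Set.mem_compl_iff, Set.mem_union, not_or] at h3
      exact h3.1 ⟨p, hMF hpM, p.start_mem⟩
    omega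
  let larger : Set (Set V) := {E | E ⊆ U ∧ PredClosed r E ∧ D ⊂ E}
  have hlargerfin : larger.Finite := hUfin.finite_subsets.subset fun D hD => hD.1
  obtain ⟨E, hEmin⟩ := hlargerfin.exists_minimal ⟨U, subset_rfl, hUclosed,
    hDU.ssubset_of_ne (fun h => hUnotsmall (h ▸ hDs))⟩
  obtain ⟨hEU, hEc, hDE⟩ := hEmin.prop
  have hElarge : ¬ 4 * (pathsWithin M E).card < M.card := fun h =>
    hDE.not_subset (hDmax.le_of_ge ⟨hEU, hEc, h⟩ hDE.subset)
  have hconn : ∀ u ∈ E \ D, ∀ v ∈ E \ D, Relation.ReflTransGen r u v := by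
    intro v hv u hu
    -- Adding to `D` the ancestors of `u` in `E` gives a closed set strictly above `D`, hence all of
    -- `E` by minimality.
    have hmem : D ∪ {w ∈ E | Relation.ReflTransGen r w u} ∈ larger := by
      refine ⟨Set.union_subset hDU fun w hw => hEU hw.1, ?_, ?_⟩
      · rintro x w hxw (hw | hw)
        · exact Or.inl (hDc _ _ hxw hw)
        · exact Or.inr ⟨hEc _ _ hxw hw.1, hw.2.head hxw⟩
      · refine Set.ssubset_iff_subset_ne.2 ⟨Set.subset_union_left, fun h => hu.2 ?_⟩
        rw [h]
        exact Or.inr ⟨hu.1, .refl⟩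
    have hle := hEmin.le_of_le hmem (Set.union_subset hDE.subset fun w hw => hw.1)
    exact ((hle hv.1).resolve_left hv.2).2
  have hcomp := hX (E \ D) hconn (fun v hv => (hEU hv.1).1)
    (Set.disjoint_left.2 fun v hv => (hEU hv.1).2)
  by_cases hE : 4 * (pathsWithin M E).card ≤ 3 * M.card
  · exact ⟨E, hEc, E, Or.inl rfl, by omega, hE⟩
  have hD := hbad D hDc
  refine ⟨D, hDc, _, Or.inr rfl, by omega, ?_⟩
  -- If both `E` and `(D ∪ X)ᶜ` held more than three quarters of `M`, more than half would lie in
  -- both, hence in `E \ D`.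
  by_contra hcon
  classical
  have hsub : pathsWithin M E ∩ pathsWithin M (D ∪ X)ᶜ ⊆ pathsWithin M (E \ D) := by
    intro p hp
    obtain ⟨h1, h2⟩ := Finset.mem_inter.1 hp
    rw [mem_pathsWithin] at h1 h2 ⊢
    exact ⟨h1.1, fun v hv => ⟨h1.2 v hv, fun h => h2.2 v hv (Or.inl h)⟩⟩
  have h1 := Finset.card_le_card hsub
  have h2 := Finset.card_union_add_card_inter (pathsWithin M E) (pathsWithin M (D ∪ X)ᶜ)
  have h3 := Finset.card_le_card
    (Finset.union_subset (pathsWithin_subset M E) (pathsWithin_subset M (D ∪ X)ᶜ))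
  omega

/-- Paths crossing either side of a cut are hit or cross the cut. -/
theorem pathsCrossing_side_subset [DecidableEq (DiPath G)] (L : Finset (DiPath G))
    {X D S : Set V} (hS : S = D ∨ S = (D ∪ X)ᶜ) :
    pathsCrossing L S ⊆ pathsMeeting L X ∪ pathsCrossing L D := by
  rcases hS with rfl | rfl
  · exact Finset.subset_union_right
  · intro p hp
    simp only [Finset.mem_union, mem_pathsMeeting, mem_pathsCrossing, Set.mem_compl_iff,
      Set.mem_union] at hp ⊢
    grind

end

/-! ### Subtrees of an arborescence -/

section

variable {T : Type*}

theorem Arborescence.below_refl (R : Arborescence T) (t : T) : R.Below t t := ⟨0, rfl⟩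

theorem Arborescence.below_root (R : Arborescence T) (t : T) : R.Below R.root t :=
  R.reaches_root t

theorem Arborescence.Below.trans {R : Arborescence T} {a b c : T} (h : R.Below a b)
    (h' : R.Below b c) : R.Below a c := by
  obtain ⟨n, rfl⟩ := h
  obtain ⟨m, rfl⟩ := h'
  exact ⟨n + m, Function.iterate_add_apply _ _ _ _⟩

/-- A proper descendant lies below a child. -/
theorem Arborescence.Below.eq_or_exists_child {R : Arborescence T} {t s : T}
    (h : R.Below t s) : s = t ∨ ∃ c, c ≠ R.root ∧ R.parent c = t ∧ R.Below c s := by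
  obtain ⟨n, hn⟩ := h
  induction n generalizing s with
  | zero => exact Or.inl hn
  | succ n ih =>
    rw [Function.iterate_succ_apply] at hn
    rcases ih hn with h | ⟨c, hc, hct, hcs⟩
    · by_cases hs : s = R.root
      · left
        rw [← h, hs, R.parent_root]
      · exact Or.inr ⟨s, hs, h, R.below_refl s⟩
    · exact Or.inr ⟨c, hc, hct, hcs.trans ⟨1, rfl⟩⟩

theorem Arborescence.Below.antisymm {R : Arborescence T} {s t : T} (h : R.Below s t)
    (h' : R.Below t s) : s = t := by
  obtain ⟨n, hn⟩ := h
  obtain ⟨m, hm⟩ := h'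
  rcases Nat.eq_zero_or_pos n with rfl | hpos
  · exact hn.symm
  have hper : Function.IsPeriodicPt R.parent (m + n) t := by
    rw [Function.IsPeriodicPt, Function.IsFixedPt, Function.iterate_add_apply, hn, hm]
  obtain ⟨j, hj⟩ := R.reaches_root t
  -- `t` is periodic under `parent`, but its orbit ends at the fixed root. A multiple of the period
  -- that is at least `j` returns to `t` and also lands on the root.
  have ht : t = R.root := by
    have h1 := hper.mul_const j
    have h2 : j ≤ (m + n) * j := Nat.le_mul_of_pos_left j (by omega)
    obtain ⟨i, hi⟩ := Nat.exists_eq_add_of_le' h2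
    rw [hi, Function.IsPeriodicPt, Function.IsFixedPt, Function.iterate_add_apply, hj,
      Function.iterate_fixed R.parent_root] at h1
    exact h1.symm
  subst ht
  rw [← hn]
  exact Function.iterate_fixed R.parent_root n

theorem Arborescence.not_below_child {R : Arborescence T} {c : T} (hc : c ≠ R.root) :
    ¬ R.Below c (R.parent c) := by
  intro h
  have h1 : R.Below (R.parent c) c := ⟨1, rfl⟩
  have h2 := h.antisymm h1
  exact hc (by
    obtain ⟨n, hn⟩ := R.reaches_root c
    rwa [Function.iterate_fixed h2.symm] at hn)

end

/-! ### From a decomposition to a balancing bag -/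

section

variable {V : Type*} {G : Digraph V}

/-- Translates mutual reachability outside `Y` into the list form that the guard condition of a
decomposition speaks about. -/
theorem exists_closed_walk {W : Type*} {H : Digraph W} {Y : Set W} {u v : W}
    (huv : Relation.ReflTransGen (fun a b => H.Adj a b ∧ a ∉ Y ∧ b ∉ Y) u v)
    (hvu : Relation.ReflTransGen (fun a b => H.Adj a b ∧ a ∉ Y ∧ b ∉ Y) v u) (hu : u ∉ Y) :
    ∃ (l : List W) (hl : IsWalk H l), l.head hl.1 = l.getLast hl.1 ∧ (∀ w ∈ l, w ∉ Y) ∧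
      u ∈ l ∧ v ∈ l := by
  obtain ⟨l₁, h₁, e₁⟩ := List.exists_isChain_cons_of_relationReflTransGen huv
  obtain ⟨l₂, h₂, e₂⟩ := List.exists_isChain_cons_of_relationReflTransGen hvu
  have hch : List.IsChain (fun a b => H.Adj a b ∧ a ∉ Y ∧ b ∉ Y) ((u :: l₁) ++ l₂) := by
    refine List.IsChain.append h₁ h₂.tail ?_
    intro x hx y hy
    have hx' : x = v := by
      rw [List.getLast?_eq_getLast_of_ne_nil (List.cons_ne_nil _ _), e₁] at hx
      simpa using hx.symm
    subst hx'
    cases l₂ with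
    | nil => simp at hy
    | cons z l =>
      have : z = y := by simpa using hy
      subst this
      exact (List.isChain_cons_cons.1 h₂).1
  refine ⟨(u :: l₁) ++ l₂, ⟨by simp, hch.imp fun _ _ h => h.1⟩, ?_, ?_, by simp, ?_⟩
  · cases l₂ with
    | nil =>
      have : v = u := e₂
      subst this
      simp [e₁]
    | cons z l =>
      rw [List.getLast_append_of_ne_nil _ (List.cons_ne_nil z l)]
      rw [List.getLast_cons (List.cons_ne_nil z l)] at e₂
      simp [e₂]
  · exact hch.induction (· ∉ Y) _ (fun _ _ h _ => h.2.2) (fun _ => hu)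
  · have hv := List.getLast_mem (List.cons_ne_nil u l₁)
    rw [e₁] at hv
    exact List.mem_append_left _ hv

theorem reflTransGen_pathUnion {F : Set (DiPath G)} {X : Set V} {u v : V}
    (h : Relation.ReflTransGen (arcAvoiding F X) u v) (hu : u ∈ unionVerts F) :
    ∃ hv : v ∈ unionVerts F, Relation.ReflTransGen
      (fun a b : {v : V // ∃ p ∈ F, v ∈ p.verts} => (pathUnion F).Adj a b ∧
        a ∉ Subtype.val ⁻¹' X ∧ b ∉ Subtype.val ⁻¹' X) ⟨u, hu⟩ ⟨v, hv⟩ := by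
  induction h with
  | refl => exact ⟨hu, .refl⟩
  | tail _ hbc ih =>
    obtain ⟨hv, ih⟩ := ih
    obtain ⟨⟨p, hp, hi⟩, hb, hc⟩ := hbc
    exact ⟨⟨p, hp, hi.subset (by simp)⟩, ih.tail ⟨⟨p, hp, hi⟩, hb, hc⟩⟩

/-- A directed tree decomposition of a union of paths has a full bag whose deletion leaves no
strong component with more than half of the paths of `M`. -/
theorem exists_fullBag_balanced {F : Set (DiPath G)} {T : Type*} [Finite T]
    (D : DirTreeDecomp (pathUnion F) T) {M : Finset (DiPath G)} (hMF : ↑M ⊆ F) :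
    ∃ t : T, ∀ C : Set V,
      (∀ u ∈ C, ∀ v ∈ C, Relation.ReflTransGen
        (arcAvoiding F (Subtype.val '' D.fullBag t)) u v) →
      C ⊆ unionVerts F → Disjoint C (Subtype.val '' D.fullBag t) →
      2 * (pathsWithin M C).card ≤ M.card := by
  classical
  rcases M.eq_empty_or_nonempty with rfl | hMne
  · exact ⟨D.root, fun C _ _ _ => by simp [pathsWithin]⟩
  let B : T → Set V := fun t => {v | ∃ (hv : v ∈ unionVerts F) (s : T),
    D.toArborescence.Below t s ∧ (⟨v, hv⟩ : {v : V // ∃ p ∈ F, v ∈ p.verts}) ∈ D.bag s}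
  have hBroot : pathsWithin M (B D.root) = M := by
    refine (pathsWithin_subset _ _).antisymm fun p hp => mem_pathsWithin.2 ⟨hp, fun v hv => ?_⟩
    have hvF : v ∈ unionVerts F := ⟨p, hMF hp, hv⟩
    obtain ⟨s, hs, -⟩ := D.bag_partition ⟨v, hvF⟩
    exact ⟨hvF, s, D.below_root s, hs⟩
  let heavy : Set T := {t | M.card < 2 * (pathsWithin M (B t)).card}
  have hroot : D.root ∈ heavy := by
    have := hMne.card_pos
    change M.card < 2 * (pathsWithin M (B D.root)).card
    rw [hBroot]
    omega
  -- A lowest node whose subtree holds more than half of `M`; all its children are light.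
  obtain ⟨t, ht, htmin⟩ := heavy.toFinite.exists_minimalFor
    (fun t => {s | D.toArborescence.Below t s}) heavy ⟨_, hroot⟩
  have hchild : ∀ c, c ≠ D.root → D.parent c = t → 2 * (pathsWithin M (B c)).card ≤ M.card := by
    intro c hc hct
    by_contra! hcon
    have hle : {s | D.toArborescence.Below c s} ≤ {s | D.toArborescence.Below t s} :=
      fun s hs => Arborescence.Below.trans ⟨1, hct⟩ hs
    have h := htmin hcon hle (D.below_refl t)
    rw [← hct] at h
    exact Arborescence.not_below_child hc h
  refine ⟨t, fun C hC hCF hCX => ?_⟩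
  -- If `C` meets the subtree of `t`, it does so below a child, as the bag of `t` is deleted; the
  -- guard of that arc is deleted too and traps `C` there. Otherwise `C` is disjoint from a heavy
  -- set.
  by_cases hmeet : ∃ v ∈ C, v ∈ B t
  · obtain ⟨v, hvC, hvF, s, hts, hvs⟩ := hmeet
    have hvX : (⟨v, hvF⟩ : {v : V // ∃ p ∈ F, v ∈ p.verts}) ∉ D.fullBag t := fun h =>
      Set.disjoint_left.1 hCX hvC ⟨_, h, rfl⟩
    rcases hts.eq_or_exists_child with rfl | ⟨c, hc, hct, hcs⟩
    · exact absurd (Or.inl hvs) hvX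
    refine le_trans ?_ (hchild c hc hct)
    refine Nat.mul_le_mul_left 2 (Finset.card_le_card (pathsWithin_mono fun w hwC => ?_))
    obtain ⟨hwF, hvw⟩ := reflTransGen_pathUnion (hC v hvC w hwC) hvF
    obtain ⟨hvF', hwv⟩ := reflTransGen_pathUnion (hC w hwC v hvC) hwF
    simp only [Set.preimage_image_eq _ Subtype.val_injective] at hvw hwv
    obtain ⟨l, hl, hcl, hlX, hvl, hwl⟩ := exists_closed_walk hvw hwv hvX
    obtain ⟨s', hs', hws'⟩ := D.guarded c hc l hl hcl
      (fun x hx hxg => hlX x hx (Or.inr ⟨c, hc, Or.inr hct, hxg⟩)) _ hvl _ hwl ⟨s, hcs, hvs⟩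
    exact ⟨hwF, s', hs', hws'⟩
  · have hdisj : Disjoint C (B t) := Set.disjoint_left.2 fun v hv hv' => hmeet ⟨v, hv, hv'⟩
    have h1 := Finset.card_union_of_disjoint (disjoint_pathsWithin (L := M) hdisj)
    have h2 := Finset.card_le_card
      (Finset.union_subset (pathsWithin_subset M C) (pathsWithin_subset M (B t)))
    have h3 : M.card < 2 * (pathsWithin M (B t)).card := ht
    omega

/-- Restricting to the paths within `S` costs a path within `S` only neighbours crossing `S`. -/
theorem card_pathsMeeting_le_within_add {L M : Finset (DiPath G)} (hM : M ⊆ L) {S : Set V}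
    {p : DiPath G} (hp : ∀ v ∈ p.verts, v ∈ S) :
    (pathsMeeting M {v | v ∈ p.verts}).card ≤
      (pathsMeeting (pathsWithin M S) {v | v ∈ p.verts}).card + (pathsCrossing L S).card := by
  classical
  refine le_trans (Finset.card_le_card fun q hq => ?_) (Finset.card_union_le _ _)
  obtain ⟨hqM, v, hvq, hvp⟩ := mem_pathsMeeting.1 hq
  rw [Finset.mem_union, mem_pathsMeeting, mem_pathsCrossing, mem_pathsWithin]
  by_cases h : ∀ w ∈ q.verts, w ∈ S
  · exact Or.inl ⟨⟨hqM, h⟩, v, hvq, hvp⟩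
  · push Not at h
    exact Or.inr ⟨hM hqM, ⟨v, hvq, hp v hvp⟩, h⟩

/-! ### The density descent -/

/-- The chord of the concave logarithm between 1 and 4/3, obtained from Bernoulli's inequality with
exponent `3 * (x - 1)` in `[0, 1]`. -/
theorem le_logb_four_thirds {x : ℝ} (h1 : 1 ≤ x) (h2 : x ≤ 4 / 3) :
    3 * (x - 1) ≤ Real.logb (4 / 3) x := by
  rw [Real.le_logb_iff_rpow_le (by norm_num) (by linarith)]
  have h := rpow_one_add_le_one_add_mul_self (s := 1 / 3) (by norm_num)
    (p := 3 * (x - 1)) (by linarith) (by linarith)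
  norm_num at h ⊢
  linarith

/-- If every large subfamily of `P` has a balanced side of a cut crossed by few paths, then no
large subfamily is dense in the intersection graph. -/
theorem false_of_dense {P Q : Finset (DiPath G)} {k : ℕ} (hk : 0 < k)
    (hsplit : ∀ M ⊆ P, 32 * k < M.card → ∃ S : Set V, (pathsCrossing P S).card ≤ 8 * k ∧
      (pathsCrossing Q S).card ≤ 8 * k ∧ 0 < (pathsWithin M S).card ∧
      4 * (pathsWithin M S).card ≤ 3 * M.card)
    {M N : Finset (DiPath G)} (hM : M ⊆ P) (hN : N ⊆ Q) {d : ℕ} (hcard : 24 * k ≤ M.card)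
    (hd : 8 * (k : ℝ) * Real.logb (4 / 3) ((M.card : ℝ) / (24 * (k : ℝ))) + 24 * (k : ℝ) + 4
      ≤ (d : ℝ))
    (hMN : ∀ p ∈ M, d ≤ (pathsMeeting N {v | v ∈ p.verts}).card)
    (hNM : ∀ q ∈ N, d ≤ (pathsMeeting M {v | v ∈ q.verts}).card) : False := by
  have hkR : (0 : ℝ) < k := by exact_mod_cast hk
  induction hn : M.card using Nat.strong_induction_on generalizing M N d with
  | _ n ih =>
  subst hn
  have le_card : ∀ {M' N' : Finset (DiPath G)} {e : ℕ}, 0 < M'.card → 0 < e →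
      (∀ p ∈ M', e ≤ (pathsMeeting N' {v | v ∈ p.verts}).card) →
      (∀ q ∈ N', e ≤ (pathsMeeting M' {v | v ∈ q.verts}).card) → e ≤ M'.card := by
    intro M' N' e h0 he hMN' hNM'
    obtain ⟨p, hp⟩ := Finset.card_pos.1 h0
    obtain ⟨q, hq⟩ := Finset.card_pos.1 (he.trans_le (hMN' p hp))
    exact (hNM' q (mem_pathsMeeting.1 hq).1).trans
      (Finset.card_le_card fun _ h => (mem_pathsMeeting.1 h).1)
  have hcardR : 24 * (k : ℝ) ≤ M.card := by exact_mod_cast hcard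
  have hlog : 0 ≤ Real.logb (4 / 3) ((M.card : ℝ) / (24 * (k : ℝ))) :=
    Real.logb_nonneg (by norm_num) ((one_le_div (by positivity)).2 hcardR)
  have hdpos : 0 < d := by
    have : (0 : ℝ) < d := by nlinarith [mul_nonneg hkR.le hlog]
    exact_mod_cast this
  have hdM : d ≤ M.card := le_card (by omega) hdpos hMN hNM
  -- The threshold is `32k = (4/3) · 24k`, where the logarithm equals 1. Up to it, the chord bound
  -- gives `d ≥ |M| + 4`, against `d ≤ |M|`.
  rcases le_or_gt M.card (32 * k) with hsmall | hlarge
  · have hsmallR : (M.card : ℝ) ≤ 32 * k := by exact_mod_cast hsmall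
    have hdMR : (d : ℝ) ≤ M.card := by exact_mod_cast hdM
    have h := le_logb_four_thirds (x := (M.card : ℝ) / (24 * (k : ℝ)))
      ((one_le_div (by positivity)).2 hcardR)
      ((div_le_iff₀ (by positivity)).2 (by linarith))
    have h1 := mul_le_mul_of_nonneg_left h (by positivity : (0 : ℝ) ≤ 8 * k)
    have h2 : 8 * (k : ℝ) * (3 * ((M.card : ℝ) / (24 * (k : ℝ)) - 1)) = M.card - 24 * k := by
      field_simp
      ring
    linarith
  · obtain ⟨S, hSP, hSQ, hpos, hbal⟩ := hsplit M hM hlarge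
    have hlargeR : 32 * (k : ℝ) < M.card := by exact_mod_cast hlarge
    have hMpos : (0 : ℝ) < M.card := by linarith
    have hposR : (0 : ℝ) < (pathsWithin M S).card := by exact_mod_cast hpos
    have hbalR : 4 * ((pathsWithin M S).card : ℝ) ≤ 3 * M.card := by exact_mod_cast hbal
    have hlog1 : 1 ≤ Real.logb (4 / 3) ((M.card : ℝ) / (24 * (k : ℝ))) := by
      rw [Real.le_logb_iff_rpow_le (by norm_num) (by positivity), Real.rpow_one,
        le_div_iff₀ (by positivity)]
      linarith
    have hlogS : Real.logb (4 / 3) (((pathsWithin M S).card : ℝ) / (24 * (k : ℝ))) ≤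
        Real.logb (4 / 3) ((M.card : ℝ) / (24 * (k : ℝ))) - 1 := by
      rw [← Real.logb_self_eq_one (b := 4 / 3) (by norm_num),
        ← Real.logb_div (by positivity) (by norm_num)]
      refine Real.logb_le_logb_of_le (by norm_num) (by positivity) ?_
      rw [div_div, div_le_div_iff₀ (by positivity) (by positivity)]
      nlinarith
    have hd32 : 32 * k + 4 ≤ d := by
      have : 32 * (k : ℝ) + 4 ≤ d := by nlinarith
      exact_mod_cast this
    have hMN' : ∀ p ∈ pathsWithin M S,
        d - 8 * k ≤ (pathsMeeting (pathsWithin N S) {v | v ∈ p.verts}).card := by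
      intro p hp
      rw [mem_pathsWithin] at hp
      have h1 := hMN p hp.1
      have h2 := card_pathsMeeting_le_within_add hN hp.2
      omega
    have hNM' : ∀ q ∈ pathsWithin N S,
        d - 8 * k ≤ (pathsMeeting (pathsWithin M S) {v | v ∈ q.verts}).card := by
      intro q hq
      rw [mem_pathsWithin] at hq
      have h1 := hNM q hq.1
      have h2 := card_pathsMeeting_le_within_add hM hq.2
      omega
    -- One surviving path suffices: its remaining degree `d - 8k ≥ 24k + 4` forces the new family to
    -- have at least `24k` members.
    have hcardS := le_card hpos (by omega) hMN' hNM'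
    refine ih (pathsWithin M S).card (by omega) ((pathsWithin_subset M S).trans hM)
      ((pathsWithin_subset N S).trans hN) (d := d - 8 * k) (by omega) ?_ hMN' hNM' rfl
    rw [Nat.cast_sub (by omega)]
    push_cast
    nlinarith

/-! ### Degrees in the intersection graph -/

theorem intersectionGraph_adj_inl {L K : Finset (DiPath G)} {p : {p // p ∈ L}}
    {x : {p // p ∈ L} ⊕ {q // q ∈ K}} (h : (intersectionGraph L K).Adj (Sum.inl p) x) :
    ∃ q : {q // q ∈ K}, x = Sum.inr q ∧ ∃ v, v ∈ p.1.verts ∧ v ∈ q.1.verts := by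
  rcases ((SimpleGraph.fromRel_adj _ _ _).1 h).2 with ⟨p', q, hp, rfl, hv⟩ | ⟨p', q, -, hp, -⟩
  · exact ⟨q, rfl, Sum.inl_injective hp ▸ hv⟩
  · cases hp

theorem intersectionGraph_adj_inr {L K : Finset (DiPath G)} {q : {q // q ∈ K}}
    {x : {p // p ∈ L} ⊕ {q // q ∈ K}} (h : (intersectionGraph L K).Adj (Sum.inr q) x) :
    ∃ p : {p // p ∈ L}, x = Sum.inl p ∧ ∃ v, v ∈ p.1.verts ∧ v ∈ q.1.verts := by
  rcases ((SimpleGraph.fromRel_adj _ _ _).1 h).2 with ⟨p, q', hq, -, -⟩ | ⟨p, q', rfl, hq, hv⟩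
  · cases hq
  · exact ⟨p, rfl, Sum.inr_injective hq ▸ hv⟩

open Classical in
theorem minDegree_le_card_pathsMeeting_right {L K : Finset (DiPath G)} {p : DiPath G}
    (hp : p ∈ L) :
    (intersectionGraph L K).minDegree ≤ (pathsMeeting K {v | v ∈ p.verts}).card := by
  refine ((intersectionGraph L K).minDegree_le_degree (Sum.inl ⟨p, hp⟩)).trans ?_
  rw [← SimpleGraph.card_neighborFinset_eq_degree]
  refine Finset.card_le_card_of_injOn (Sum.elim Subtype.val Subtype.val) ?_ ?_
  · intro x h
    obtain ⟨q, rfl, v, hvp, hvq⟩ := intersectionGraph_adj_inl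
      ((SimpleGraph.mem_neighborFinset _ _ _).1 h)
    exact mem_pathsMeeting.2 ⟨q.2, v, hvq, hvp⟩
  · intro x h y h' e
    obtain ⟨q, rfl, -⟩ := intersectionGraph_adj_inl ((SimpleGraph.mem_neighborFinset _ _ _).1 h)
    obtain ⟨q', rfl, -⟩ := intersectionGraph_adj_inl ((SimpleGraph.mem_neighborFinset _ _ _).1 h')
    exact congrArg Sum.inr (Subtype.ext e)

open Classical in
theorem minDegree_le_card_pathsMeeting_left {L K : Finset (DiPath G)} {q : DiPath G}
    (hq : q ∈ K) :
    (intersectionGraph L K).minDegree ≤ (pathsMeeting L {v | v ∈ q.verts}).card := by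
  refine ((intersectionGraph L K).minDegree_le_degree (Sum.inr ⟨q, hq⟩)).trans ?_
  rw [← SimpleGraph.card_neighborFinset_eq_degree]
  refine Finset.card_le_card_of_injOn (Sum.elim Subtype.val Subtype.val) ?_ ?_
  · intro x h
    obtain ⟨p, rfl, v, hvp, hvq⟩ := intersectionGraph_adj_inr
      ((SimpleGraph.mem_neighborFinset _ _ _).1 h)
    exact mem_pathsMeeting.2 ⟨p.2, v, hvp, hvq⟩
  · intro x h y h' e
    obtain ⟨p, rfl, -⟩ := intersectionGraph_adj_inr ((SimpleGraph.mem_neighborFinset _ _ _).1 h)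
    obtain ⟨p', rfl, -⟩ := intersectionGraph_adj_inr ((SimpleGraph.mem_neighborFinset _ _ _).1 h')
    exact congrArg Sum.inl (Subtype.ext e)

end

end HalfIntegralLinkage

open HalfIntegralLinkage in
open Classical in
theorem mainTheorem4 {V : Type*} (G : Digraph V) (k d : ℕ) (hk : 0 < k)
    (P Pback Q Qback : Finset (DiPath G))
    (hP : IsHalfIntegralLinkage P) (hPback : IsHalfIntegralLinkage Pback)
    (hQ : IsHalfIntegralLinkage Q) (hQback : IsHalfIntegralLinkage Qback)
    (hPdual : AreDual P Pback) (hQdual : AreDual Q Qback)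
    (hcard : 24 * k ≤ P.card)
    (hd : 8 * (k : ℝ) * Real.logb (4 / 3) ((P.card : ℝ) / (24 * (k : ℝ))) + 24 * (k : ℝ) + 4
      ≤ (d : ℝ))
    (hdeg : d ≤ (intersectionGraph P Q).minDegree) :
    k ≤ directedTreewidth
      (pathUnion ((P : Set (DiPath G)) ∪ (Pback : Set (DiPath G)) ∪ (Q : Set (DiPath G)) ∪
        (Qback : Set (DiPath G)))) := by
  set F : Set (DiPath G) := (P : Set (DiPath G)) ∪ (Pback : Set (DiPath G)) ∪
    (Q : Set (DiPath G)) ∪ (Qback : Set (DiPath G)) with hFdef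
  have hF : F.Finite := ((P.finite_toSet.union Pback.finite_toSet).union Q.finite_toSet).union
    Qback.finite_toSet
  have hPF : (P : Set (DiPath G)) ⊆ F := fun p hp => Or.inl (Or.inl (Or.inl hp))
  have hPbF : (Pback : Set (DiPath G)) ⊆ F := fun p hp => Or.inl (Or.inl (Or.inr hp))
  have hQF : (Q : Set (DiPath G)) ⊆ F := fun p hp => Or.inl (Or.inr hp)
  have hQbF : (Qback : Set (DiPath G)) ⊆ F := fun p hp => Or.inr hp
  by_contra! hlt
  have : Finite {v : V // ∃ p ∈ F, v ∈ p.verts} := finite_unionVerts hF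
  obtain ⟨n, T, hT⟩ := Nat.sInf_mem (s := {w | HasDirTreeDecomp (pathUnion F) w})
    (exists_hasDirTreeDecomp (pathUnion F))
  refine false_of_dense hk (P := P) (Q := Q) (fun M hM hMcard => ?_) subset_rfl subset_rfl
    hcard hd (fun p hp => hdeg.trans (minDegree_le_card_pathsMeeting_right hp))
    (fun q hq => hdeg.trans (minDegree_le_card_pathsMeeting_left hq))
  have hMF : (M : Set (DiPath G)) ⊆ F := (Finset.coe_subset.2 hM).trans hPF
  obtain ⟨t, ht⟩ := exists_fullBag_balanced T hMF
  have hX : (Subtype.val '' T.fullBag t).encard ≤ k := by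
    rw [Subtype.val_injective.injOn.encard_image]
    refine (hT t).trans ?_
    exact_mod_cast hlt
  have hPX : ∀ D, PredClosed (arcAvoiding F (Subtype.val '' T.fullBag t)) D → _ := fun D hD =>
    card_pathsMeeting_union_crossing_le hP hPback hPdual hPF hPbF hX hD
  have hQX : ∀ D, PredClosed (arcAvoiding F (Subtype.val '' T.fullBag t)) D → _ := fun D hD =>
    card_pathsMeeting_union_crossing_le hQ hQback hQdual hQF hQbF hX hD
  -- At most `b = 6k` paths are lost to the cut, and `2b = 12k < 32k < |M|`.
  obtain ⟨D, hD, S, hS, hpos, hbal⟩ := exists_balanced_side hF hMF (b := 6 * k)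
    (fun D hD => (card_le_card_pathsWithin_add hM _ D).trans
      (Nat.add_le_add_left (hPX D hD) _)) (by omega) ht
  have hcross : ∀ {L : Finset (DiPath G)}, (pathsMeeting L (Subtype.val '' T.fullBag t) ∪
      pathsCrossing L D).card ≤ 6 * k → (pathsCrossing L S).card ≤ 8 * k := fun h =>
    (Finset.card_le_card (pathsCrossing_side_subset _ hS)).trans (h.trans (by omega))
  exact ⟨S, hcross (hPX D hD), hcross (hQX D hD), hpos, hbal⟩
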